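/- Let $Q$ be a finite quiver. Let $\Phi$ be a $Q^{\mathrm{op}}$-diagram of Grothendieck categories, i.e. a Grothendieck category $\Phi_i$ for every vertex $i$ and a left exact additive functor $\Phi_a:\Phi_j\to\Phi_i$ for every arrow $a:i\to j$, and suppose that every $\Phi_a$ has an exact left adjoint $\Psi_a:\Phi_i\to\Phi_j$. Let $\mathcal R(\Phi)$ be the category whose objects $X$ consist of objects $X_i\in\Phi_i$ for all vertices $i$ and morphisms $X_a:X_i\to\Phi_aX_j$ for all arrows $a:i\to j$, and whose morphisms $f:X\to Y$ are families of morphisms $f_i:X_i\to Y_i$ with $\Phi_a(f_j)\circ X_a=Y_a\circ f_i$ for all arrows $a:i\to j$. It is an abelian category. Write $\tilde X_a:\Psi_aX_i\to X_j$ for the morphism adjoint to $X_a$. Then for any $X,Y\in\mathcal R(\Phi)$ there is a long exact sequence of abelian groups \begin{multline*} 0\to\operatorname{Hom}_{\mathcal R(\Phi)}(X,Y)\to\bigoplus_{i}\operatorname{Hom}_{\Phi_i}(X_i,Y_i)\to\bigoplus_{a:i\to j}\operatorname{Hom}_{\Phi_j}(\Psi_aX_i,Y_j)\\ \to\operatorname{Ext}^1_{\mathcal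 R(\Phi)}(X,Y)\to\bigoplus_{i}\operatorname{Ext}^1_{\Phi_i}(X_i,Y_i)\to\bigoplus_{a:i\to j}\operatorname{Ext}^1_{\Phi_j}(\Psi_aX_i,Y_j)\to\operatorname{Ext}^2_{\mathcal R(\Phi)}(X,Y)\to\cdots \end{multline*} in which, in every degree $k\ge 0$ (with $\operatorname{Ext}^0=\operatorname{Hom}$), the map out of $\operatorname{Ext}^k_{\mathcal R(\Phi)}(X,Y)$ is induced by the exact functors $X\mapsto X_i$, and the map out of $\bigoplus_i\operatorname{Ext}^k_{\Phi_i}(X_i,Y_i)$ sends $(e_i)_i$ to the family $(\tilde Y_a\circ\Psi_a(e_i)-e_j\circ\tilde X_a)_{a:i\to j}$. -/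

import Mathlib

open CategoryTheory CategoryTheory.Limits
open scoped ZeroObject

universe w q t v u

/-- Twisted representations of a quiver `Q` with respect to a `Qᵒᵖ`-diagram of categories, which
consists of a category `C i` for every vertex `i` and a functor `Φ a : C j ⥤ C i` for every arrow
`a : i ⟶ j`. (Giving these functors on arrows is the same as giving a functor on the opposite of
the path category, and a representation of the path category is determined by its values on
arrows, which can be arbitrary.) -/
structure DRep {Q : Type t} [Quiver.{q} Q] {C : Q → Type u} [∀ i, Category.{v} (C i)]
    (Φ : ∀ ⦃i j : Q⦄, (i ⟶ j) → C j ⥤ C i) where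
  /-- The object `X_i` at the vertex `i`. -/
  obj (i : Q) : C i
  /-- The morphism `X_a : X_i ⟶ Φ_a X_j` at the arrow `a : i ⟶ j`. -/
  map {i j : Q} (a : i ⟶ j) : obj i ⟶ (Φ a).obj (obj j)

namespace DRep

section Category

variable {Q : Type t} [Quiver.{q} Q] {C : Q → Type u} [∀ i, Category.{v} (C i)]
  {Φ : ∀ ⦃i j : Q⦄, (i ⟶ j) → C j ⥤ C i}

/-- Morphisms of representations. -/
@[ext]
structure Hom (X Y : DRep Φ) where
  /-- The component `f_i : X_i ⟶ Y_i`. -/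
  app (i : Q) : X.obj i ⟶ Y.obj i
  comm {i j : Q} (a : i ⟶ j) : X.map a ≫ (Φ a).map (app j) = app i ≫ Y.map a

instance : Category (DRep Φ) where
  Hom X Y := Hom X Y
  id X := { app := fun i => 𝟙 (X.obj i), comm := by simp }
  comp f g :=
    { app := fun i => f.app i ≫ g.app i
      comm := fun a => by
        rw [Functor.map_comp, ← Category.assoc, f.comm, Category.assoc, g.comm, Category.assoc] }

@[ext]
theorem hom_ext {X Y : DRep Φ} {f g : X ⟶ Y} (h : ∀ i, f.app i = g.app i) : f = g :=
  Hom.ext (funext h)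

@[simp]
theorem id_app (X : DRep Φ) (i : Q) : Hom.app (𝟙 X) i = 𝟙 (X.obj i) := rfl

@[simp]
theorem comp_app {X Y Z : DRep Φ} (f : X ⟶ Y) (g : Y ⟶ Z) (i : Q) :
    (f ≫ g).app i = f.app i ≫ g.app i := rfl

theorem comm {X Y : DRep Φ} (f : X ⟶ Y) {i j : Q} (a : i ⟶ j) :
    X.map a ≫ (Φ a).map (f.app j) = f.app i ≫ Y.map a := Hom.comm f a

variable (Φ) in
/-- The forgetful functor `X ↦ X_i`. -/
@[simps]
def eval (i : Q) : DRep Φ ⥤ C i where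
  obj X := X.obj i
  map f := f.app i

theorem isIso_of_app {X Y : DRep Φ} (f : X ⟶ Y) (h : ∀ i, IsIso (f.app i)) : IsIso f := by
  refine ⟨⟨{ app := fun i => inv (f.app i), comm := fun a => ?_ }, ?_, ?_⟩⟩
  · rw [Functor.map_inv, IsIso.comp_inv_eq, Category.assoc, comm, IsIso.inv_hom_id_assoc]
  · ext i; exact IsIso.hom_inv_id (f.app i)
  · ext i; exact IsIso.inv_hom_id (f.app i)

end Category

section Abelian

variable {Q : Type t} [Quiver.{q} Q] {C : Q → Type u} [∀ i, Category.{v} (C i)]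
  [∀ i, Abelian (C i)] {Φ : ∀ ⦃i j : Q⦄, (i ⟶ j) → C j ⥤ C i}
  [∀ (i j : Q) (a : i ⟶ j), (Φ a).Additive]

instance (X Y : DRep Φ) : Zero (X ⟶ Y) :=
  ⟨{ app := fun _ => 0, comm := by simp }⟩

instance (X Y : DRep Φ) : Add (X ⟶ Y) :=
  ⟨fun f g =>
    { app := fun i => f.app i + g.app i
      comm := fun a => by simp [Functor.map_add, comm] }⟩

instance (X Y : DRep Φ) : Neg (X ⟶ Y) :=
  ⟨fun f =>
    { app := fun i => -f.app i
      comm := fun a => by simp [Functor.map_neg, comm] }⟩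

@[simp]
theorem zero_app (X Y : DRep Φ) (i : Q) : Hom.app (0 : X ⟶ Y) i = 0 := rfl

@[simp]
theorem add_app {X Y : DRep Φ} (f g : X ⟶ Y) (i : Q) :
    Hom.app (f + g) i = f.app i + g.app i := rfl

@[simp]
theorem neg_app {X Y : DRep Φ} (f : X ⟶ Y) (i : Q) : Hom.app (-f) i = -f.app i := rfl

instance (X Y : DRep Φ) : AddCommGroup (X ⟶ Y) where
  add_assoc f g h := by ext i; simp [add_assoc]
  zero_add f := by ext i; simp
  add_zero f := by ext i; simp
  neg_add_cancel f := by ext i; simp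
  add_comm f g := by ext i; simp [add_comm]
  nsmul := nsmulRec
  zsmul := zsmulRec

instance : Preadditive (DRep Φ) where
  add_comp X Y Z f f' g := by ext i; simp
  comp_add X Y Z f g g' := by ext i; simp

instance (i : Q) : (eval Φ i).Additive where

/-- The zero representation. -/
noncomputable def zeroObj (Φ : ∀ ⦃i j : Q⦄, (i ⟶ j) → C j ⥤ C i) : DRep Φ where
  obj _ := 0
  map _ := 0

instance : HasZeroObject (DRep Φ) :=
  ⟨zeroObj Φ, (IsZero.iff_id_eq_zero _).2 (by
    ext i; exact (IsZero.iff_id_eq_zero (0 : C i)).1 (isZero_zero (C i)))⟩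

/-- Componentwise binary biproducts. -/
noncomputable def biprodObj (X Y : DRep Φ) : DRep Φ where
  obj i := biprod (X.obj i) (Y.obj i)
  map {_ j} a := biprod.desc (X.map a ≫ (Φ a).map (biprod.inl : X.obj j ⟶ X.obj j ⊞ Y.obj j))
    (Y.map a ≫ (Φ a).map (biprod.inr : Y.obj j ⟶ X.obj j ⊞ Y.obj j))

/-- The componentwise biproduct with its structure maps. -/
noncomputable def biprodData (X Y : DRep Φ) : BinaryBicone X Y where
  pt := biprodObj X Y
  fst :=
    { app := fun i => (biprod.fst : X.obj i ⊞ Y.obj i ⟶ X.obj i)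
      comm := fun a => by
        dsimp [biprodObj]
        ext <;> simp [← Functor.map_comp] }
  snd :=
    { app := fun i => (biprod.snd : X.obj i ⊞ Y.obj i ⟶ Y.obj i)
      comm := fun a => by
        dsimp [biprodObj]
        ext <;> simp [← Functor.map_comp] }
  inl :=
    { app := fun i => (biprod.inl : X.obj i ⟶ X.obj i ⊞ Y.obj i)
      comm := fun a => by simp [biprodObj] }
  inr :=
    { app := fun i => (biprod.inr : Y.obj i ⟶ X.obj i ⊞ Y.obj i)
      comm := fun a => by simp [biprodObj] }
  inl_fst := by ext i; exact biprod.inl_fst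
  inl_snd := by ext i; exact biprod.inl_snd
  inr_fst := by ext i; exact biprod.inr_fst
  inr_snd := by ext i; exact biprod.inr_snd

instance : HasBinaryBiproducts (DRep Φ) :=
  ⟨fun X Y => CategoryTheory.Limits.HasBinaryBiproduct.mk ⟨biprodData X Y, isBinaryBilimitOfTotal _ (by
    ext i
    exact biprod.total (X := X.obj i) (Y := Y.obj i))⟩⟩

instance : HasFiniteProducts (DRep Φ) :=
  hasFiniteProducts_of_has_binary_and_terminal

/-- The componentwise cokernel. -/
noncomputable def cokernelObj {X Y : DRep Φ} (f : X ⟶ Y) : DRep Φ where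
  obj i := cokernel (f.app i)
  map {i j} a := cokernel.desc (f.app i) (Y.map a ≫ (Φ a).map (cokernel.π (f.app j))) (by
    rw [← Category.assoc, ← comm, Category.assoc, ← Functor.map_comp, cokernel.condition,
      Functor.map_zero, comp_zero])

/-- The projection to the componentwise cokernel. -/
noncomputable def cokernelπ {X Y : DRep Φ} (f : X ⟶ Y) : Y ⟶ cokernelObj f :=
  Hom.mk (fun i => cokernel.π (f.app i)) (fun a => by simp [cokernelObj])

theorem comp_cokernelπ {X Y : DRep Φ} (f : X ⟶ Y) : f ≫ cokernelπ f = 0 := by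
  ext i; exact cokernel.condition (f.app i)

/-- The componentwise cokernel is a cokernel. -/
noncomputable def isColimitCokernel {X Y : DRep Φ} (f : X ⟶ Y) :
    IsColimit (CokernelCofork.ofπ (cokernelπ f) (comp_cokernelπ f)) :=
  CokernelCofork.IsColimit.ofπ _ _
    (fun {Z} g hg => Hom.mk
      (fun i => cokernel.desc (f.app i) (g.app i) (by rw [← comp_app, hg, zero_app]))
      (fun a => by
        dsimp [cokernelObj]
        rw [← cancel_epi (cokernel.π _)]
        simp [← Functor.map_comp, comm]))
    (fun {Z} g hg => by ext i; exact cokernel.π_desc _ _ _)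
    (fun {Z} g hg m hm => by
      ext i
      refine (cancel_epi (cokernel.π (f.app i))).1 ?_
      rw [cokernel.π_desc, ← hm]
      rfl)

instance : HasCokernels (DRep Φ) := ⟨fun f => ⟨⟨_, isColimitCokernel f⟩⟩⟩

instance {X Y : DRep Φ} (f : X ⟶ Y) (i : Q) :
    PreservesColimit (parallelPair f 0) (eval Φ i) :=
  preservesColimit_of_preserves_colimit_cocone (isColimitCokernel f)
    ((CokernelCofork.isColimitMapCoconeEquiv _ (eval Φ i)).2
      (cokernelIsCokernel (f.app i)))

variable [∀ (i j : Q) (a : i ⟶ j), PreservesFiniteLimits (Φ a)]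

/-- Left exactness: `Φ_a` of a kernel is a kernel. -/
noncomputable def isLimitMapKernel {i j : Q} (a : i ⟶ j) {M N : C j} (g : M ⟶ N) :
    IsLimit (KernelFork.ofι ((Φ a).map (kernel.ι g))
      (show (Φ a).map (kernel.ι g) ≫ (Φ a).map g = 0 by
        rw [← Functor.map_comp, kernel.condition, Functor.map_zero])) :=
  isLimitForkMapOfIsLimit' (Φ a) (kernel.condition g) (kernelIsKernel g)

instance {i j : Q} (a : i ⟶ j) {M N : C j} (g : M ⟶ N) [Mono g] : Mono ((Φ a).map g) :=
  inferInstance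

/-- The componentwise kernel. -/
noncomputable def kernelObj {X Y : DRep Φ} (f : X ⟶ Y) : DRep Φ where
  obj i := kernel (f.app i)
  map {i j} a := (isLimitMapKernel a (f.app j)).lift
    (KernelFork.ofι (kernel.ι (f.app i) ≫ X.map a) (by
      rw [Category.assoc, comm, kernel.condition_assoc, zero_comp]))

theorem kernelObj_map_comp {X Y : DRep Φ} (f : X ⟶ Y) {i j : Q} (a : i ⟶ j) :
    (kernelObj f).map a ≫ (Φ a).map (kernel.ι (f.app j)) = kernel.ι (f.app i) ≫ X.map a :=
  Fork.IsLimit.lift_ι (isLimitMapKernel a (f.app j))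

/-- The inclusion of the componentwise kernel. -/
noncomputable def kernelι {X Y : DRep Φ} (f : X ⟶ Y) : kernelObj f ⟶ X :=
  Hom.mk (fun i => kernel.ι (f.app i)) (fun a => kernelObj_map_comp f a)

theorem kernelι_comp {X Y : DRep Φ} (f : X ⟶ Y) : kernelι f ≫ f = 0 := by
  ext i; exact kernel.condition (f.app i)

/-- The componentwise kernel is a kernel. -/
noncomputable def isLimitKernel {X Y : DRep Φ} (f : X ⟶ Y) :
    IsLimit (KernelFork.ofι (kernelι f) (kernelι_comp f)) :=
  KernelFork.IsLimit.ofι _ _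
    (fun {Z} g hg => Hom.mk
      (fun i => kernel.lift (f.app i) (g.app i) (by rw [← comp_app, hg, zero_app]))
      (fun {i j} a => by
        refine (cancel_mono ((Φ a).map (kernel.ι (f.app j)))).1 ?_
        refine Eq.trans ?_ (Eq.trans (comm g a) ?_)
        · refine (Category.assoc _ _ _).trans ?_
          have h : (Φ a).map (kernel.lift (f.app j) (g.app j) (by rw [← comp_app, hg, zero_app])) ≫
              (Φ a).map (kernel.ι (f.app j)) = (Φ a).map (g.app j) := by
            rw [← Functor.map_comp, kernel.lift_ι]
          exact congrArg (fun m => Z.map a ≫ m) h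
        · refine Eq.trans ?_ (Category.assoc _ _ _).symm
          refine Eq.trans ?_ (congrArg (fun m => kernel.lift (f.app i) (g.app i) _ ≫ m)
            (kernelObj_map_comp f a).symm)
          exact (kernel.lift_ι_assoc _ _ _ _).symm))
    (fun {Z} g hg => by ext i; exact kernel.lift_ι _ _ _)
    (fun {Z} g hg m hm => by
      ext i
      refine (cancel_mono (kernel.ι (f.app i))).1 ?_
      rw [kernel.lift_ι, ← hm]
      rfl)

instance : HasKernels (DRep Φ) := ⟨fun f => ⟨⟨_, isLimitKernel f⟩⟩⟩

instance {X Y : DRep Φ} (f : X ⟶ Y) (i : Q) :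
    PreservesLimit (parallelPair f 0) (eval Φ i) :=
  preservesLimit_of_preserves_limit_cone (isLimitKernel f)
    ((KernelFork.isLimitMapConeEquiv _ (eval Φ i)).2
      (kernelIsKernel (f.app i)))

theorem isIso_coimageImageComparison {X Y : DRep Φ} (f : X ⟶ Y) :
    IsIso (Abelian.coimageImageComparison f) := by
  refine isIso_of_app _ (fun i => ?_)
  have h := Abelian.PreservesCoimage.hom_coimageImageComparison (eval Φ i) f
  have h' : (eval Φ i).map (Abelian.coimageImageComparison f) =
      (Abelian.PreservesCoimage.iso (eval Φ i) f).hom ≫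
        Abelian.coimageImageComparison ((eval Φ i).map f) ≫
          (Abelian.PreservesImage.iso (eval Φ i) f).inv := by
    rw [← Category.assoc, h, Category.assoc, Iso.hom_inv_id, Category.comp_id]
  change IsIso ((eval Φ i).map (Abelian.coimageImageComparison f))
  rw [h']
  infer_instance

/-- Representations of a left exact diagram of abelian categories form an abelian category. -/
noncomputable instance : Abelian (DRep Φ) :=
  have := fun {X Y : DRep Φ} (f : X ⟶ Y) => isIso_coimageImageComparison f
  Abelian.ofCoimageImageComparisonIsIso

instance (i : Q) : PreservesFiniteLimits (eval Φ i) :=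
  Functor.preservesFiniteLimits_of_preservesKernels (eval Φ i)

instance (i : Q) : PreservesFiniteColimits (eval Φ i) :=
  Functor.preservesFiniteColimits_of_preservesCokernels (eval Φ i)

/-- `Ext` groups of representations, in a universe where they always exist. -/
instance hasExt : HasExt.{max t q u v} (DRep Φ) := HasExt.standard (DRep Φ)

end Abelian

section Maps

variable {Q : Type t} [Quiver.{q} Q] {C : Q → Type u} [∀ i, Category.{v} (C i)]
  [∀ i, Abelian (C i)]
  {Φ : ∀ ⦃i j : Q⦄, (i ⟶ j) → C j ⥤ C i} {Ψ : ∀ ⦃i j : Q⦄, (i ⟶ j) → C i ⥤ C j}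

/-- The morphism `Ψ_a X_i ⟶ X_j` corresponding to `X_a : X_i ⟶ Φ_a X_j` by adjunction. -/
def adjMap (adj : ∀ ⦃i j : Q⦄ (a : i ⟶ j), Ψ a ⊣ Φ a) (X : DRep Φ) {i j : Q} (a : i ⟶ j) :
    (Ψ a).obj (X.obj i) ⟶ X.obj j :=
  ((adj a).homEquiv _ _).symm (X.map a)

variable [∀ (i j : Q) (a : i ⟶ j), (Φ a).Additive]

/-- The map `Hom(X, Y) → ⨁_i Hom(X_i, Y_i)`, `f ↦ (f_i)_i`. (Direct sums of abelian groups over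
the finite sets of vertices and of arrows are written as products.) -/
def homRes (X Y : DRep Φ) : (X ⟶ Y) →+ (∀ i : Q, X.obj i ⟶ Y.obj i) where
  toFun f i := f.app i
  map_zero' := rfl
  map_add' _ _ := rfl

/-- The map `⨁_i Hom(X_i, Y_i) → ⨁_{a : i ⟶ j} Hom(Ψ_a X_i, Y_j)` sending `(f_i)_i` to the family
`Y_a ∘ Ψ_a(f_i) - f_j ∘ X_a`, where `X_a : Ψ_a X_i ⟶ X_j` and `Y_a : Ψ_a Y_i ⟶ Y_j`. -/
def homDiff (adj : ∀ ⦃i j : Q⦄ (a : i ⟶ j), Ψ a ⊣ Φ a)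
    [∀ (i j : Q) (a : i ⟶ j), (Ψ a).Additive] (X Y : DRep Φ) :
    (∀ i : Q, X.obj i ⟶ Y.obj i) →+
      (∀ (i j : Q) (a : i ⟶ j), (Ψ a).obj (X.obj i) ⟶ Y.obj j) where
  toFun f i j a := (Ψ a).map (f i) ≫ adjMap adj Y a - adjMap adj X a ≫ f j
  map_zero' := by
    funext i j a
    simp
  map_add' f g := by
    funext i j a
    simp only [Pi.add_apply, Functor.map_add, Preadditive.add_comp, Preadditive.comp_add]
    abel

variable [∀ i, IsGrothendieckAbelian.{w} (C i)]
  [∀ (i j : Q) (a : i ⟶ j), PreservesFiniteLimits (Φ a)]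

/-- The map `Ext^k(X, Y) → ⨁_i Ext^k(X_i, Y_i)` given by the exact functors `X ↦ X_i`. -/
noncomputable def extRes (X Y : DRep Φ) (k : ℕ) :
    Abelian.Ext.{max t q u v} X Y k →+ (∀ i : Q, Abelian.Ext.{w} (X.obj i) (Y.obj i) k) :=
  AddMonoidHom.mk' (fun e i => (eval Φ i).mapExtAddHom X Y k e) (fun e e' => by
    funext i
    exact map_add _ e e')

/-- The map `⨁_i Ext^k(X_i, Y_i) → ⨁_{a : i ⟶ j} Ext^k(Ψ_a X_i, Y_j)` sending `(e_i)_i` to the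
family `Y_a ∘ Ψ_a(e_i) - e_j ∘ X_a`, where `X_a : Ψ_a X_i ⟶ X_j` and `Y_a : Ψ_a Y_i ⟶ Y_j`. -/
noncomputable def extDiff (adj : ∀ ⦃i j : Q⦄ (a : i ⟶ j), Ψ a ⊣ Φ a)
    [∀ (i j : Q) (a : i ⟶ j), (Ψ a).Additive]
    [∀ (i j : Q) (a : i ⟶ j), PreservesFiniteLimits (Ψ a)]
    [∀ (i j : Q) (a : i ⟶ j), PreservesFiniteColimits (Ψ a)] (X Y : DRep Φ) (k : ℕ) :
    (∀ i : Q, Abelian.Ext.{w} (X.obj i) (Y.obj i) k) →+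
      (∀ (i j : Q) (a : i ⟶ j), Abelian.Ext.{w} ((Ψ a).obj (X.obj i)) (Y.obj j) k) :=
  AddMonoidHom.mk'
    (fun e i j a =>
      ((Ψ a).mapExtAddHom (X.obj i) (Y.obj i) k (e i)).comp
          (Abelian.Ext.mk₀ (adjMap adj Y a)) (add_zero k) -
        (Abelian.Ext.mk₀ (adjMap adj X a)).comp (e j) (zero_add k))
    (fun e e' => by
      funext i j a
      simp only [Pi.add_apply, map_add, Abelian.Ext.add_comp, Abelian.Ext.comp_add]
      abel)

end Maps

end DRep

/-! A family `f_i : X_i ⟶ Y_i` is a morphism of representations exactly when, in adjoint form, its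
defect `homDiff` vanishes; this is the left end of the sequence. Everything else comes from
embedding `Y` into a representation `I` on which all terms are acyclic, namely the one coinduced
from injective objects `J i`, with `I_i` the product of the `Φ_p J_j` over all paths `p` starting at
`i`.

Three properties of `I` carry the argument. It is injective, by its universal property
(`injective_coind`). Its components are injective, because right adjoints of exact functors preserve
injectives (`injective_coind_obj`). And `homDiff` into `I` is surjective, because a family with
prescribed defect can be built by recursion on the length of paths (`exists_coind_family`).

Put `K = I / Y`. The `Ext` sequences of `0 → Y → I → K → 0` over `X`, over the vertices and over the
arrows are compatible; for the connecting maps this is the naturality of extension classes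
(`extDiff_extRes_extClass`). In degree `0` the snake lemma gives the connecting map. As the positive
`Ext` groups into `I` and its components vanish, the piece of the sequence for `Y` starting in
degree `k + 1` is obtained from the piece for `K` starting in degree `k`. -/

/-! ### Diagram chases in abelian groups -/

theorem injective_of_exact_of_subsingleton {A B D : Type*} [AddCommGroup A] [AddCommGroup B]
    [AddCommGroup D] [Subsingleton A] {f : A →+ B} {g : B →+ D} (h : Function.Exact f g) :
    Function.Injective g :=
  (injective_iff_map_eq_zero g).2 fun x hx => by
    obtain ⟨y, rfl⟩ := (h x).1 hx
    rw [Subsingleton.elim y 0, map_zero]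

/-- The snake connecting map, in the form used to start a long exact sequence: the columns
`0 → EI → AI → BI → 0` and `0 → EK → AK → BK` are exact, and the rows are parts of long exact
sequences starting with `0 → BY`, in which the terms after `EY'` and `AY'` vanish. -/
theorem exists_snake_connecting {EI EK EY' AY AI AK AY' BY BI BK BY' : Type*}
    [AddCommGroup EI] [AddCommGroup EK] [AddCommGroup EY'] [AddCommGroup AY] [AddCommGroup AI]
    [AddCommGroup AK] [AddCommGroup AY'] [AddCommGroup BY] [AddCommGroup BI] [AddCommGroup BK]
    [AddCommGroup BY']
    {πE : EI →+ EK} {sE : EK →+ EY'} {ιA : AY →+ AI} {πA : AI →+ AK} {sA : AK →+ AY'}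
    {ιB : BY →+ BI} {πB : BI →+ BK} {sB : BK →+ BY'}
    {rI : EI →+ AI} {rK : EK →+ AK} {rY' : EY' →+ AY'}
    {dY : AY →+ BY} {dI : AI →+ BI} {dK : AK →+ BK} {dY' : AY' →+ BY'}
    (hE : Function.Exact πE sE) (hsE : Function.Surjective sE)
    (hA : Function.Exact ιA πA) (hA' : Function.Exact πA sA) (hsA : Function.Surjective sA)
    (hιB : Function.Injective ιB) (hB : Function.Exact ιB πB) (hB' : Function.Exact πB sB)
    (hI : Function.Exact rI dI) (hdI : Function.Surjective dI)
    (hrK : Function.Injective rK) (hK : Function.Exact rK dK)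
    (cπE : ∀ x, rK (πE x) = πA (rI x)) (csE : ∀ x, rY' (sE x) = sA (rK x))
    (cι : ∀ x, dI (ιA x) = ιB (dY x)) (cπ : ∀ x, dK (πA x) = πB (dI x))
    (cs : ∀ x, dY' (sA x) = sB (dK x)) :
    ∃ δ : BY →+ EY', Function.Exact dY δ ∧ Function.Exact δ rY' ∧ Function.Exact rY' dY' := by
  -- The snake: lift the image of `h` along `dI` to `f`. Then `πA f` has no defect, so it comes from
  -- some `e`, and `δ h` is `sE e`.
  have lift (h : BY) : ∃ (f : AI) (e : EK), dI f = ιB h ∧ rK e = πA f := by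
    obtain ⟨f, hf⟩ := hdI (ιB h)
    obtain ⟨e, he⟩ := (hK (πA f)).1 (by rw [cπ, hf, hB.apply_apply_eq_zero])
    exact ⟨f, e, hf, he⟩
  -- Two choices of `f` differ by an element of the image of `rI`, which changes `e` only by an
  -- element of the image of `πE`, killed by `sE`.
  have uniq {f : AI} {e : EK} (hf : dI f = 0) (he : rK e = πA f) : sE e = 0 := by
    obtain ⟨x, rfl⟩ := (hI f).1 hf
    rw [← cπE] at he
    rw [hrK he, hE.apply_apply_eq_zero]
  choose F E hF hE' using lift
  have key {h : BY} {f : AI} {e : EK} (hf : dI f = ιB h) (he : rK e = πA f) :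
      sE (E h) = sE e := by
    rw [← sub_eq_zero, ← map_sub]
    exact uniq (f := F h - f) (by rw [map_sub, hF, hf, sub_self])
      (by rw [map_sub, map_sub, hE', he])
  refine ⟨AddMonoidHom.mk' (fun h => sE (E h)) fun h h' => ?_, fun h => ⟨fun hh => ?_, ?_⟩,
    fun x => ⟨fun hx => ?_, ?_⟩, fun y => ⟨fun hy => ?_, ?_⟩⟩
  · rw [← map_add]
    exact key (f := F h + F h') (by simp [hF]) (by simp [hE'])
  · obtain ⟨x, hx⟩ := (hE (E h)).1 hh
    obtain ⟨g, hg⟩ := (hA (F h - rI x)).1 (by rw [map_sub, ← cπE, hx, hE', sub_self])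
    refine ⟨g, hιB ?_⟩
    rw [← cι, hg, map_sub, hF, hI.apply_apply_eq_zero, sub_zero]
  · rintro ⟨g, rfl⟩
    refine (key (f := ιA g) (e := 0) (cι g) ?_).trans (map_zero _)
    rw [map_zero, hA.apply_apply_eq_zero]
  · obtain ⟨e, rfl⟩ := hsE x
    rw [csE] at hx
    obtain ⟨f, hf⟩ := (hA' _).1 hx
    obtain ⟨h, hh⟩ := (hB (dI f)).1 (by rw [← cπ, hf, hK.apply_apply_eq_zero])
    exact ⟨h, key hh.symm hf.symm⟩
  · rintro ⟨h, rfl⟩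
    change rY' (sE (E h)) = 0
    rw [csE, hE', hA'.apply_apply_eq_zero]
  · obtain ⟨g, rfl⟩ := hsA y
    rw [cs] at hy
    obtain ⟨b, hb⟩ := (hB' _).1 hy
    obtain ⟨f, rfl⟩ := hdI b
    -- Subtracting `πA f` removes the defect of `g` without changing `sA g`.
    obtain ⟨e, he⟩ := (hK (g - πA f)).1 (by rw [map_sub, cπ, hb, sub_self])
    exact ⟨sE e, by rw [csE, he, map_sub, hA'.apply_apply_eq_zero, sub_zero]⟩
  · rintro ⟨x, rfl⟩
    obtain ⟨e, rfl⟩ := hsE x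
    rw [csE, cs, hK.apply_apply_eq_zero, map_zero]

/-- Exactness of `A → B → E' → A' → B'` is transported along a dimension shift. -/
theorem exists_shift_connecting {A B E' A' B' sA sB sE' sA' sB' : Type*}
    [AddCommGroup A] [AddCommGroup B] [AddCommGroup E'] [AddCommGroup A'] [AddCommGroup B']
    [AddCommGroup sA] [AddCommGroup sB] [AddCommGroup sE'] [AddCommGroup sA'] [AddCommGroup sB']
    {d : A →+ B} {δ : B →+ E'} {r : E' →+ A'} {d' : A' →+ B'}
    {d₁ : sA →+ sB} {r₁ : sE' →+ sA'} {d₁' : sA' →+ sB'}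
    {a : A →+ sA} {b : B →+ sB} {e : E' →+ sE'} {a' : A' →+ sA'} {b' : B' →+ sB'}
    (ha : Function.Surjective a) (hb : Function.Surjective b) (he : Function.Bijective e)
    (ha' : Function.Bijective a') (hb' : Function.Injective b')
    (hker : ∀ x, b x = 0 → ∃ y, a y = 0 ∧ d y = x)
    (cd : ∀ x, d₁ (a x) = b (d x)) (cr : ∀ x, r₁ (e x) = a' (r x))
    (cd' : ∀ x, d₁' (a' x) = b' (d' x))
    (hd : Function.Exact d δ) (hδ : Function.Exact δ r) (hr : Function.Exact r d') :
    ∃ δ₁ : sB →+ sE', Function.Exact d₁ δ₁ ∧ Function.Exact δ₁ r₁ ∧ Function.Exact r₁ d₁' := by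
  -- By `hker` the kernel of `b` lies in the image of `d`, which `δ` kills; hence `e ∘ δ` descends
  -- along the surjection `b`.
  have kill : b.ker ≤ (e.comp δ).ker := by
    intro x hx
    obtain ⟨y, -, rfl⟩ := hker x hx
    simp [AddMonoidHom.mem_ker, hd.apply_apply_eq_zero]
  let δ₁ : sB →+ sE' := b.liftOfSurjective hb ⟨e.comp δ, kill⟩
  have hδ₁ (x : B) : δ₁ (b x) = e (δ x) :=
    b.liftOfRightInverse_comp_apply _ _ ⟨e.comp δ, kill⟩ x
  refine ⟨δ₁, fun x => ⟨fun hx => ?_, ?_⟩, fun x => ⟨fun hx => ?_, ?_⟩,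
    fun x => ⟨fun hx => ?_, ?_⟩⟩
  · obtain ⟨x, rfl⟩ := hb x
    rw [hδ₁] at hx
    obtain ⟨y, rfl⟩ := (hd x).1 (he.1 (hx.trans (map_zero e).symm))
    exact ⟨a y, cd y⟩
  · rintro ⟨y, rfl⟩
    obtain ⟨y, rfl⟩ := ha y
    rw [cd, hδ₁, hd.apply_apply_eq_zero, map_zero]
  · obtain ⟨x, rfl⟩ := he.2 x
    rw [cr] at hx
    obtain ⟨y, rfl⟩ := (hδ x).1 (ha'.1 (hx.trans (map_zero a').symm))
    exact ⟨b y, hδ₁ y⟩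
  · rintro ⟨y, rfl⟩
    obtain ⟨y, rfl⟩ := hb y
    rw [hδ₁, cr, hδ.apply_apply_eq_zero, map_zero]
  · obtain ⟨x, rfl⟩ := ha'.2 x
    rw [cd'] at hx
    obtain ⟨y, rfl⟩ := (hr x).1 (hb' (hx.trans (map_zero b').symm))
    exact ⟨e y, cr y⟩
  · rintro ⟨y, rfl⟩
    obtain ⟨y, rfl⟩ := he.2 y
    rw [cr, cd', hr.apply_apply_eq_zero, map_zero]

namespace DRep

/-! ### Coinduced representations and their injectivity -/

section Coinduced

variable {Q : Type t} [Quiver.{q} Q] [Finite Q] [∀ i j : Q, Finite (i ⟶ j)]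
  {C : Q → Type u} [∀ i, Category.{v} (C i)] [∀ i, Abelian (C i)]
  {Φ : ∀ ⦃i j : Q⦄, (i ⟶ j) → C j ⥤ C i} (J : ∀ i, C i)

variable (Φ) in
/-- The `n`-th layer of the coinduced representation: the product of the `Φ_p J_j` over all paths
`p : i ⟶ j` of length `n`. -/
noncomputable def layer (J : ∀ i, C i) : ℕ → ∀ i, C i
  | 0, i => J i
  | n + 1, i => ∏ᶜ fun p : Σ j, (i ⟶ j) => (Φ p.2).obj (layer J n p.1)

/-- The projection from the layer `n + 1` to the layer `n` at an arrow. -/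
noncomputable def layerπ (n : ℕ) {i j : Q} (a : i ⟶ j) :
    layer Φ J (n + 1) i ⟶ (Φ a).obj (layer Φ J n j) :=
  Pi.π (fun p : Σ j, (i ⟶ j) => (Φ p.2).obj (layer Φ J n p.1)) ⟨j, a⟩

theorem layer_hom_ext {n : ℕ} {i : Q} {M : C i} {f g : M ⟶ layer Φ J (n + 1) i}
    (h : ∀ ⦃j : Q⦄ (a : i ⟶ j), f ≫ layerπ J n a = g ≫ layerπ J n a) : f = g :=
  Pi.hom_ext _ _ fun p => h p.2

variable [∀ i, HasProductsOfShape ℕ (C i)]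
  [∀ (i j : Q) (a : i ⟶ j), PreservesLimitsOfShape (Discrete ℕ) (Φ a)]

variable (Φ) in
/-- The product of all layers. -/
noncomputable def coindObj (i : Q) : C i := ∏ᶜ fun n : ℕ => layer Φ J n i

variable (Φ) in
/-- The functors `Φ_a` preserve the products of layers. -/
noncomputable def isLimitMapCoindObj {i j : Q} (a : i ⟶ j) :
    IsLimit (Fan.mk ((Φ a).obj (coindObj Φ J j)) fun n =>
      (Φ a).map (Pi.π (fun n : ℕ => layer Φ J n j) n)) :=
  isLimitFanMkObjOfIsLimit (Φ a) _ _ (productIsProduct fun n : ℕ => layer Φ J n j)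

variable (Φ) in
/-- The representation coinduced from a family of objects. -/
noncomputable def coind : DRep Φ where
  obj := coindObj Φ J
  map {i _} a := Fan.IsLimit.lift (isLimitMapCoindObj Φ J a)
    fun n => Pi.π (fun n : ℕ => layer Φ J n i) (n + 1) ≫ layerπ J n a

/-- The projection of the coinduced representation to a layer. -/
noncomputable def coindπ (n : ℕ) (i : Q) : (coind Φ J).obj i ⟶ layer Φ J n i :=
  Pi.π (fun n : ℕ => layer Φ J n i) n

variable (Φ) in
/-- The projection of the coinduced representation to the objects it is coinduced from. -/
noncomputable def coindBase (i : Q) : (coind Φ J).obj i ⟶ J i := coindπ J 0 i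

variable {J} in
theorem coind_hom_ext {i : Q} {M : C i} {f g : M ⟶ (coind Φ J).obj i}
    (h : ∀ n, f ≫ coindπ J n i = g ≫ coindπ J n i) : f = g :=
  Pi.hom_ext _ _ h

variable {J} in
theorem coind_map_hom_ext {i j : Q} {a : i ⟶ j} {M : C i} {f g : M ⟶ (Φ a).obj ((coind Φ J).obj j)}
    (h : ∀ n, f ≫ (Φ a).map (coindπ J n j) = g ≫ (Φ a).map (coindπ J n j)) : f = g :=
  Fan.IsLimit.hom_ext (isLimitMapCoindObj Φ J a) _ _ h

variable {J} in
theorem exists_coind_lift {i : Q} {M : C i} (f : ∀ n, M ⟶ layer Φ J n i) :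
    ∃ g : M ⟶ (coind Φ J).obj i, ∀ n, g ≫ coindπ J n i = f n :=
  ⟨Pi.lift f, fun _ => Pi.lift_π _ _⟩

theorem coind_map_comp_π {i j : Q} (a : i ⟶ j) (n : ℕ) :
    (coind Φ J).map a ≫ (Φ a).map (coindπ J n j) = coindπ J (n + 1) i ≫ layerπ J n a :=
  Fan.IsLimit.fac (isLimitMapCoindObj Φ J a) _ n

variable {J} in
-- Agreement on layer `n` propagates to layer `n + 1`: compatibility with an arrow `a` expresses the
-- `a`-component of the latter through `Φ a` applied to the former.
theorem coind_ext {X : DRep Φ} {f g : X ⟶ coind Φ J}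
    (h : ∀ i, f.app i ≫ coindBase Φ J i = g.app i ≫ coindBase Φ J i) : f = g := by
  have key (n : ℕ) : ∀ i, f.app i ≫ coindπ J n i = g.app i ≫ coindπ J n i := by
    induction n with
    | zero => exact h
    | succ n ih =>
      intro i
      refine layer_hom_ext J fun j a => ?_
      rw [Category.assoc, Category.assoc, ← coind_map_comp_π, ← Category.assoc, ← Category.assoc,
        ← comm, ← comm, Category.assoc, Category.assoc, ← Functor.map_comp, ← Functor.map_comp, ih]
  ext i
  exact coind_hom_ext fun n => key n i

variable {J} in
/-- The equations `Φ_a(f_j) ∘ X_a + h_a = I_a ∘ f_i` for a family `f_i : X_i ⟶ I_i`, where `I` is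
the representation coinduced from `J`, can be solved with prescribed composites
`X_i ⟶ I_i ⟶ J_i`. -/
theorem exists_coind_family {X : DRep Φ} (g : ∀ i, X.obj i ⟶ J i)
    (h : ∀ (i j : Q) (a : i ⟶ j), X.obj i ⟶ (Φ a).obj ((coind Φ J).obj j)) :
    ∃ f : ∀ i, X.obj i ⟶ (coind Φ J).obj i, (∀ i, f i ≫ coindBase Φ J i = g i) ∧
      ∀ (i j : Q) (a : i ⟶ j), X.map a ≫ (Φ a).map (f j) + h i j a = f i ≫ (coind Φ J).map a := by
  -- The equation at `a`, projected to layer `n`, dictates the `a`-component of `f_i` in layer `n +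
  -- 1`; layer `0` is free and is filled by `g`.
  let l (n : ℕ) : ∀ i, X.obj i ⟶ layer Φ J n i :=
    Nat.rec g (fun n l i => Pi.lift fun p : Σ j, (i ⟶ j) =>
      X.map p.2 ≫ (Φ p.2).map (l p.1) + h i p.1 p.2 ≫ (Φ p.2).map (coindπ J n p.1)) n
  have hl (n : ℕ) {i j : Q} (a : i ⟶ j) : l (n + 1) i ≫ layerπ J n a =
      X.map a ≫ (Φ a).map (l n j) + h i j a ≫ (Φ a).map (coindπ J n j) :=
    Pi.lift_π _ _
  choose f hf using fun i => exists_coind_lift (l · i)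
  refine ⟨f, fun i => hf i 0, fun i j a => coind_map_hom_ext fun n => ?_⟩
  rw [Category.assoc, coind_map_comp_π, ← Category.assoc, hf, Preadditive.add_comp,
    Category.assoc, ← Functor.map_comp, hf, hl]

variable {J} in
theorem exists_hom_coind {X : DRep Φ} (g : ∀ i, X.obj i ⟶ J i) :
    ∃ f : X ⟶ coind Φ J, ∀ i, f.app i ≫ coindBase Φ J i = g i := by
  obtain ⟨f, hf, hf'⟩ := exists_coind_family g fun _ _ _ => 0
  exact ⟨Hom.mk f fun a => by simpa using hf' _ _ a, hf⟩

/-- A morphism into a coinduced representation amounts to a family of morphisms to the `J i`, and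
such a family extends along a monomorphism vertex by vertex. -/
theorem injective_coind [∀ (i j : Q) (a : i ⟶ j), (Φ a).Additive]
    [∀ (i j : Q) (a : i ⟶ j), PreservesFiniteLimits (Φ a)] [∀ i, Injective (J i)] :
    Injective (coind Φ J) where
  factors {X Y} g m _ := by
    have (i : Q) : Mono (m.app i) := inferInstanceAs (Mono ((eval Φ i).map m))
    obtain ⟨f, hf⟩ := exists_hom_coind
      fun i => Injective.factorThru (g.app i ≫ coindBase Φ J i) (m.app i)
    exact ⟨f, coind_ext fun i => by
      rw [comp_app, Category.assoc, hf, Injective.comp_factorThru]⟩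

/-- A representation embeds into one that is coinduced from injective objects. -/
theorem exists_mono_coind [∀ i, EnoughInjectives (C i)] (Y : DRep Φ) :
    ∃ (J : ∀ i, C i) (_ : ∀ i, Injective (J i)) (f : Y ⟶ coind Φ J), Mono f := by
  obtain ⟨f, hf⟩ := exists_hom_coind fun i => Injective.ι (Y.obj i)
  refine ⟨fun i => Injective.under (Y.obj i), fun i => inferInstance, f, ⟨fun g h hgh => ?_⟩⟩
  ext i
  have : Mono (f.app i) := mono_of_mono_fac (hf i)
  rw [← cancel_mono (f.app i), ← comp_app, hgh, comp_app]

theorem injective_pi {D : Type*} [Category D] {β : Type*} (c : β → D) [HasProduct c]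
    [∀ b, Injective (c b)] : Injective (∏ᶜ c) where
  factors g m _ := ⟨Pi.lift fun b => Injective.factorThru (g ≫ Pi.π c b) m,
    Pi.hom_ext _ _ fun b => by simp⟩

/-- The left adjoint `Ψ a` preserves monomorphisms, so `Φ a` preserves injectives; products of
injectives are injective, and induction on the layers applies. -/
theorem injective_coind_obj {Ψ : ∀ ⦃i j : Q⦄, (i ⟶ j) → C i ⥤ C j}
    (adj : ∀ ⦃i j : Q⦄ (a : i ⟶ j), Ψ a ⊣ Φ a)
    [∀ (i j : Q) (a : i ⟶ j), PreservesFiniteLimits (Ψ a)] [∀ i, Injective (J i)] (i : Q) :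
    Injective ((coind Φ J).obj i) := by
  have key (n : ℕ) : ∀ i, Injective (layer Φ J n i) := by
    induction n with
    | zero => exact fun i => inferInstanceAs (Injective (J i))
    | succ n ih =>
      intro i
      have (p : Σ j, (i ⟶ j)) : Injective ((Φ p.2).obj (layer Φ J n p.1)) :=
        have := ih p.1
        Injective.injective_of_adjoint (adj p.2) _
      exact injective_pi fun p : Σ j, (i ⟶ j) => (Φ p.2).obj (layer Φ J n p.1)
  have := fun n => key n i
  exact injective_pi fun n : ℕ => layer Φ J n i

end Coinduced

/-! ### The sequence in degree zero, and the injective embedding -/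

section Maps

variable {Q : Type t} [Quiver.{q} Q]
  {C : Q → Type u} [∀ i, Category.{v} (C i)]
  {Φ : ∀ ⦃i j : Q⦄, (i ⟶ j) → C j ⥤ C i} {Ψ : ∀ ⦃i j : Q⦄, (i ⟶ j) → C i ⥤ C j}
  (adj : ∀ ⦃i j : Q⦄ (a : i ⟶ j), Ψ a ⊣ Φ a)

theorem adjMap_naturality {X Y : DRep Φ} (f : X ⟶ Y) {i j : Q} (a : i ⟶ j) :
    (Ψ a).map (f.app i) ≫ adjMap adj Y a = adjMap adj X a ≫ f.app j := by
  rw [adjMap, adjMap, ← Adjunction.homEquiv_naturality_left_symm,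
    ← Adjunction.homEquiv_naturality_right_symm, comm]

variable [∀ i, Abelian (C i)]
  [∀ (i j : Q) (a : i ⟶ j), (Φ a).Additive] [∀ (i j : Q) (a : i ⟶ j), (Ψ a).Additive]

theorem homRes_injective (X Y : DRep Φ) : Function.Injective (homRes X Y) := fun _ _ h =>
  hom_ext fun i => congrFun h i

/-- Through the adjunction, `homDiff` measures the failure of the squares of `f` to commute. Its
kernel thus consists of the morphisms, and hitting a prescribed value is the problem solved by
`exists_coind_family`. -/
theorem homEquiv_homDiff (X Y : DRep Φ) (f : ∀ i : Q, X.obj i ⟶ Y.obj i) {i j : Q} (a : i ⟶ j) :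
    (adj a).homEquiv _ _ (homDiff adj X Y f i j a) =
      f i ≫ Y.map a - X.map a ≫ (Φ a).map (f j) := by
  have h (M : C i) (N : C j) (g g' : (Ψ a).obj M ⟶ N) :
      (adj a).homEquiv _ _ (g - g') = (adj a).homEquiv _ _ g - (adj a).homEquiv _ _ g' := by
    simp [Adjunction.homEquiv_unit]
  refine (h _ _ _ _).trans ?_
  rw [Adjunction.homEquiv_naturality_left, Adjunction.homEquiv_naturality_right, adjMap, adjMap,
    Equiv.apply_symm_apply, Equiv.apply_symm_apply]

theorem exact_homRes_homDiff (X Y : DRep Φ) :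
    Function.Exact (homRes X Y) (homDiff adj X Y) := by
  have h (f : ∀ i : Q, X.obj i ⟶ Y.obj i) : homDiff adj X Y f = 0 ↔
      ∀ (i j : Q) (a : i ⟶ j), X.map a ≫ (Φ a).map (f j) = f i ≫ Y.map a := by
    simp only [funext_iff]
    refine forall₃_congr fun i j a => ?_
    rw [← ((adj a).homEquiv _ _).apply_eq_iff_eq, homEquiv_homDiff, Pi.zero_apply, Pi.zero_apply,
      Pi.zero_apply, Adjunction.homEquiv_unit, Functor.map_zero, comp_zero, sub_eq_zero, eq_comm]
  intro f
  rw [h]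
  exact ⟨fun hf => ⟨Hom.mk f fun a => hf _ _ a, rfl⟩, by rintro ⟨f, rfl⟩ i j a; exact comm f a⟩

theorem homDiff_coind_surjective [Finite Q] [∀ i j : Q, Finite (i ⟶ j)]
    [∀ i, HasProductsOfShape ℕ (C i)]
    [∀ (i j : Q) (a : i ⟶ j), PreservesLimitsOfShape (Discrete ℕ) (Φ a)]
    (X : DRep Φ) (J : ∀ i, C i) : Function.Surjective (homDiff adj X (coind Φ J)) := by
  intro h
  obtain ⟨f, -, hf⟩ := exists_coind_family (J := J) (fun _ => 0)
    fun i j a => (adj a).homEquiv (X.obj i) ((coind Φ J).obj j) (h i j a)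
  refine ⟨f, ?_⟩
  funext i j a
  rw [← ((adj a).homEquiv _ _).apply_eq_iff_eq, homEquiv_homDiff, ← hf i j a, add_sub_cancel_left]

variable [Finite Q] [∀ i j : Q, Finite (i ⟶ j)] [∀ i, IsGrothendieckAbelian.{w} (C i)]
  [∀ (i j : Q) (a : i ⟶ j), PreservesFiniteLimits (Φ a)]
  [∀ (i j : Q) (a : i ⟶ j), PreservesFiniteLimits (Ψ a)]

/-- A representation is the first term of a short exact sequence whose second term is coinduced
from injective objects. -/
theorem exists_shortExact_injective (Y : DRep Φ) :
    ∃ S : ShortComplex (DRep Φ), S.ShortExact ∧ S.X₁ = Y ∧ Injective S.X₂ ∧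
      (∀ i, Injective (S.X₂.obj i)) ∧ ∀ X, Function.Surjective (homDiff adj X S.X₂) := by
  -- Oriented cycles give paths of unbounded length, so countable products are needed: Grothendieck
  -- categories are complete, and the right adjoints `Φ a` preserve limits.
  have (i : Q) : HasLimitsOfSize.{0, 0} (C i) := hasLimitsOfSizeShrink.{0, 0, w, w} (C i)
  have (i j : Q) (a : i ⟶ j) : PreservesLimitsOfSize.{0, 0} (Φ a) :=
    (adj a).rightAdjoint_preservesLimits
  obtain ⟨J, _, f, _⟩ := exists_mono_coind Y
  exact ⟨ShortComplex.mk f (cokernel.π f) (cokernel.condition f),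
    { exact := ShortComplex.exact_cokernel f }, rfl, injective_coind J,
    injective_coind_obj J adj, fun X => homDiff_coind_surjective adj X J⟩

end Maps

open Abelian (Ext)

/-! ### Yoneda products on families, and exactness -/

section ExtSequence

variable {Q : Type t}
  {C : Q → Type u} [∀ i, Category.{v} (C i)] [∀ i, Abelian (C i)]
  [∀ i, IsGrothendieckAbelian.{w} (C i)]

/-- Postcomposition of families of `Ext` classes over the vertices. -/
noncomputable def vertexPostcomp {X Y Z : ∀ i, C i} {n : ℕ} (s : ∀ i, Ext.{w} (Y i) (Z i) n)
    {k m : ℕ} (h : k + n = m) :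
    (∀ i, Ext.{w} (X i) (Y i) k) →+ (∀ i, Ext.{w} (X i) (Z i) m) :=
  AddMonoidHom.mk' (fun e i => (e i).comp (s i) h) fun _ _ => funext fun _ => Ext.add_comp _ _ _ _

/-- Vertexwise exactness gives exactness of postcomposition on families over the vertices. -/
theorem exact_vertexPostcomp {X Y Z W : ∀ i, C i} {n n' k m l : ℕ}
    {s : ∀ i, Ext.{w} (Y i) (Z i) n} {s' : ∀ i, Ext.{w} (Z i) (W i) n'} {h : k + n = m}
    {h' : m + n' = l}
    (H : ∀ i (M : C i), Function.Exact (fun e : Ext M (Y i) k => e.comp (s i) h)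
      (fun e => e.comp (s' i) h')) :
    Function.Exact (vertexPostcomp (X := X) s h) (vertexPostcomp s' h') := by
  intro e
  refine ⟨fun he => ?_, ?_⟩
  · choose f hf using fun i => (H i (X i) (e i)).1 (congrFun he i)
    exact ⟨f, funext hf⟩
  · rintro ⟨f, rfl⟩
    exact funext fun i => (H i (X i)).apply_apply_eq_zero (f i)

variable [Quiver.{q} Q]

/-- Postcomposition of families of `Ext` classes over the arrows. -/
noncomputable def arrowPostcomp {X : ∀ (i j : Q), (i ⟶ j) → C j} {Y Z : ∀ i, C i} {n : ℕ}
    (s : ∀ i, Ext.{w} (Y i) (Z i) n) {k m : ℕ} (h : k + n = m) :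
    (∀ (i j : Q) (a : i ⟶ j), Ext.{w} (X i j a) (Y j) k) →+
      (∀ (i j : Q) (a : i ⟶ j), Ext.{w} (X i j a) (Z j) m) :=
  AddMonoidHom.mk' (fun e i j a => (e i j a).comp (s j) h)
    fun _ _ => funext fun _ => funext fun _ => funext fun _ => Ext.add_comp _ _ _ _

/-- Vertexwise exactness gives exactness of postcomposition on families over the arrows. -/
theorem exact_arrowPostcomp {X : ∀ (i j : Q), (i ⟶ j) → C j} {Y Z W : ∀ i, C i} {n n' k m l : ℕ}
    {s : ∀ i, Ext.{w} (Y i) (Z i) n} {s' : ∀ i, Ext.{w} (Z i) (W i) n'} {h : k + n = m}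
    {h' : m + n' = l}
    (H : ∀ i (M : C i), Function.Exact (fun e : Ext M (Y i) k => e.comp (s i) h)
      (fun e => e.comp (s' i) h')) :
    Function.Exact (arrowPostcomp (X := X) s h) (arrowPostcomp s' h') := by
  intro e
  refine ⟨fun he => ?_, ?_⟩
  · choose f hf using fun i j a =>
      (H j (X i j a) (e i j a)).1 (congrFun (congrFun (congrFun he i) j) a)
    exact ⟨f, funext fun i => funext fun j => funext fun a => hf i j a⟩
  · rintro ⟨f, rfl⟩
    exact funext fun i => funext fun j => funext fun a =>
      (H j (X i j a)).apply_apply_eq_zero (f i j a)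

end ExtSequence

section Exactness

variable {D : Type*} [Category D] [Abelian D] [HasExt.{w} D] {S : ShortComplex D}
  (hS : S.ShortExact) (M : D)

include hS in
theorem exact_comp_mk₀_mk₀ (k : ℕ) :
    Function.Exact (fun e : Ext.{w} M S.X₁ k => e.comp (Ext.mk₀ S.f) (add_zero k))
      (fun e => e.comp (Ext.mk₀ S.g) (add_zero k)) :=
  fun e => ⟨fun h => Ext.covariant_sequence_exact₂ M hS e h, by rintro ⟨x, rfl⟩; simp⟩

theorem exact_comp_mk₀_extClass (k : ℕ) :
    Function.Exact (fun e : Ext.{w} M S.X₂ k => e.comp (Ext.mk₀ S.g) (add_zero k))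
      (fun e => e.comp hS.extClass rfl) :=
  fun e => ⟨fun h => Ext.covariant_sequence_exact₃ M hS e rfl h, by rintro ⟨x, rfl⟩; simp⟩

theorem comp_extClass_surjective (k : ℕ) [Subsingleton (Ext.{w} M S.X₂ (k + 1))] :
    Function.Surjective (fun e : Ext.{w} M S.X₃ k => e.comp hS.extClass rfl) :=
  fun e => Ext.covariant_sequence_exact₁ M hS e (Subsingleton.elim _ _) rfl

end Exactness

/-! ### Compatibility of restriction and defect with Yoneda products -/

section LongExactSequence

variable {Q : Type t} [Quiver.{q} Q]
  {C : Q → Type u} [∀ i, Category.{v} (C i)] [∀ i, Abelian (C i)]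
  [∀ i, IsGrothendieckAbelian.{w} (C i)]
  {Φ : ∀ ⦃i j : Q⦄, (i ⟶ j) → C j ⥤ C i}

/-- `Ext` groups in degree `0` over the vertices. -/
noncomputable def vertexEquiv₀ (X Y : ∀ i, C i) :
    (∀ i, Ext.{w} (X i) (Y i) 0) ≃+ (∀ i, X i ⟶ Y i) :=
  AddEquiv.piCongrRight fun _ => Ext.addEquiv₀

/-- `Ext` groups in degree `0` over the arrows. -/
noncomputable def arrowEquiv₀ (X : ∀ (i j : Q), (i ⟶ j) → C j) (Y : ∀ i, C i) :
    (∀ (i j : Q) (a : i ⟶ j), Ext.{w} (X i j a) (Y j) 0) ≃+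
      (∀ (i j : Q) (a : i ⟶ j), X i j a ⟶ Y j) :=
  AddEquiv.piCongrRight fun _ => AddEquiv.piCongrRight fun _ => AddEquiv.piCongrRight fun _ =>
    Ext.addEquiv₀

variable {Ψ : ∀ ⦃i j : Q⦄, (i ⟶ j) → C i ⥤ C j} (adj : ∀ ⦃i j : Q⦄ (a : i ⟶ j), Ψ a ⊣ Φ a)
  [∀ (i j : Q) (a : i ⟶ j), (Ψ a).Additive]
  [∀ (i j : Q) (a : i ⟶ j), PreservesFiniteLimits (Ψ a)]
  [∀ (i j : Q) (a : i ⟶ j), PreservesFiniteColimits (Ψ a)]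

theorem extDiff_eq_zero_iff (X Y : DRep Φ) (k : ℕ) (e : ∀ i, Ext.{w} (X.obj i) (Y.obj i) k) :
    extDiff adj X Y k e = 0 ↔ ∀ (i j : Q) (a : i ⟶ j),
      ((e i).mapExactFunctor (Ψ a)).comp (Ext.mk₀ (adjMap adj Y a)) (add_zero k) =
        (Ext.mk₀ (adjMap adj X a)).comp (e j) (zero_add k) := by
  simp only [funext_iff]
  exact forall₃_congr fun i j a => sub_eq_zero

/-- The functor `Ψ a` respects Yoneda products, and `hs` says that `Ψ a` of `s` at the source
followed by `adjMap` of `Z` equals `adjMap` of `Y` followed by `s` at the target. Associativity then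
moves `s` out of both terms. -/
theorem extDiff_vertexPostcomp {X Y Z : DRep Φ} {k n m : ℕ} (h : k + n = m)
    {s : ∀ i, Ext.{w} (Y.obj i) (Z.obj i) n} (hs : extDiff adj Y Z n s = 0)
    (e : ∀ i, Ext.{w} (X.obj i) (Y.obj i) k) :
    extDiff adj X Z m (vertexPostcomp s h e) = arrowPostcomp s h (extDiff adj X Y k e) := by
  rw [extDiff_eq_zero_iff] at hs
  funext i j a
  change (((e i).comp (s i) h).mapExactFunctor (Ψ a)).comp (Ext.mk₀ (adjMap adj Z a)) _ -
    (Ext.mk₀ (adjMap adj X a)).comp ((e j).comp (s j) h) _ =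
    (((e i).mapExactFunctor (Ψ a)).comp (Ext.mk₀ (adjMap adj Y a)) (add_zero k) -
        (Ext.mk₀ (adjMap adj X a)).comp (e j) (zero_add k)).comp (s j) h
  rw [sub_eq_add_neg, sub_eq_add_neg, Ext.add_comp, Ext.neg_comp, Ext.mapExactFunctor_comp,
    Ext.comp_assoc_of_third_deg_zero, hs, Ext.comp_assoc_of_second_deg_zero,
    Ext.comp_assoc _ _ _ (zero_add k) h (by lia)]

theorem arrowEquiv₀_extDiff (X Y : DRep Φ) (e : ∀ i, Ext.{w} (X.obj i) (Y.obj i) 0) :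
    arrowEquiv₀ (fun i _ a => (Ψ a).obj (X.obj i)) Y.obj (extDiff adj X Y 0 e) =
      homDiff adj X Y (vertexEquiv₀ X.obj Y.obj e) := by
  obtain ⟨f, rfl⟩ := (vertexEquiv₀ X.obj Y.obj).symm.surjective e
  rw [AddEquiv.apply_symm_apply]
  refine (AddEquiv.eq_symm_apply _).1 ?_
  funext i j a
  change ((Ext.mk₀ (f i)).mapExactFunctor (Ψ a)).comp (Ext.mk₀ (adjMap adj Y a)) _ -
    (Ext.mk₀ (adjMap adj X a)).comp (Ext.mk₀ (f j)) _ =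
    Ext.mk₀ ((Ψ a).map (f i) ≫ adjMap adj Y a - adjMap adj X a ≫ f j)
  rw [Ext.mapExactFunctor_mk₀, Ext.mk₀_comp_mk₀, Ext.mk₀_comp_mk₀, sub_eq_add_neg, sub_eq_add_neg,
    Ext.mk₀_add, Ext.mk₀_neg]

theorem extDiff_zero_surjective {X Y : DRep Φ} (h : Function.Surjective (homDiff adj X Y)) :
    Function.Surjective (extDiff.{w} adj X Y 0) := by
  intro e
  obtain ⟨f, hf⟩ := h (arrowEquiv₀ _ Y.obj e)
  obtain ⟨f, rfl⟩ := (vertexEquiv₀ X.obj Y.obj).surjective f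
  exact ⟨f, (arrowEquiv₀ _ Y.obj).injective ((arrowEquiv₀_extDiff adj X Y f).trans hf)⟩

variable [∀ (i j : Q) (a : i ⟶ j), (Φ a).Additive]
  [∀ (i j : Q) (a : i ⟶ j), PreservesFiniteLimits (Φ a)]

theorem extRes_mk₀ {X Y : DRep Φ} (f : X ⟶ Y) :
    extRes.{w} X Y 0 (Ext.mk₀ f) = fun i => Ext.mk₀ (f.app i) :=
  funext fun i => Ext.mapExactFunctor_mk₀ (eval Φ i) f

theorem extRes_extClass {S : ShortComplex (DRep Φ)} (hS : S.ShortExact) :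
    extRes.{w} S.X₃ S.X₁ 1 hS.extClass = fun i => (hS.map_of_exact (eval Φ i)).extClass :=
  funext fun i => Ext.mapExactFunctor_extClass (eval Φ i) hS

theorem extRes_comp {X Y Z : DRep Φ} {k n m : ℕ} (h : k + n = m)
    (e : Ext.{max t q u v} X Y k) (σ : Ext.{max t q u v} Y Z n) :
    extRes.{w} X Z m (e.comp σ h) = vertexPostcomp (extRes Y Z n σ) h (extRes X Y k e) :=
  funext fun i => Ext.mapExactFunctor_comp (eval Φ i) e σ h

theorem extDiff_extRes_mk₀ {X Y : DRep Φ} (f : X ⟶ Y) :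
    extDiff.{w} adj X Y 0 (extRes.{w} X Y 0 (Ext.mk₀ f)) = 0 := by
  rw [extDiff_eq_zero_iff, extRes_mk₀]
  intro i j a
  rw [Ext.mapExactFunctor_mk₀, Ext.mk₀_comp_mk₀, Ext.mk₀_comp_mk₀, adjMap_naturality]

/-- The maps `adjMap` form a morphism from `Ψ a` of the short exact sequence at `i` to the one at
`j`, and extension classes are natural in such morphisms. -/
theorem extDiff_extRes_extClass {S : ShortComplex (DRep Φ)} (hS : S.ShortExact) :
    extDiff.{w} adj S.X₃ S.X₁ 1 (extRes.{w} S.X₃ S.X₁ 1 hS.extClass) = 0 := by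
  rw [extDiff_eq_zero_iff, extRes_extClass]
  intro i j a
  let φ : (S.map (eval Φ i)).map (Ψ a) ⟶ S.map (eval Φ j) :=
    { τ₁ := adjMap adj S.X₁ a
      τ₂ := adjMap adj S.X₂ a
      τ₃ := adjMap adj S.X₃ a
      comm₁₂ := (adjMap_naturality adj S.f a).symm
      comm₂₃ := (adjMap_naturality adj S.g a).symm }
  refine Eq.trans ?_ (ShortComplex.ShortExact.extClass_naturality
    ((hS.map_of_exact (eval Φ i)).map_of_exact (Ψ a)) (hS.map_of_exact (eval Φ j)) φ)
  exact congrArg (fun e => e.comp (Ext.mk₀ φ.τ₁) (add_zero 1))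
    (Ext.mapExactFunctor_extClass (Ψ a) (hS.map_of_exact (eval Φ i)))

theorem vertexEquiv₀_extRes (X Y : DRep Φ) (e : Ext.{max t q u v} X Y 0) :
    vertexEquiv₀ X.obj Y.obj (extRes.{w} X Y 0 e) = homRes X Y (Ext.addEquiv₀ e) := by
  obtain ⟨f, rfl⟩ := Ext.addEquiv₀.symm.surjective e
  rw [AddEquiv.apply_symm_apply]
  change vertexEquiv₀ X.obj Y.obj (extRes.{w} X Y 0 (Ext.mk₀ f)) = _
  rw [extRes_mk₀]
  exact funext fun i => Ext.addEquiv₀.apply_symm_apply (f.app i)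

theorem extRes_zero_injective (X Y : DRep Φ) : Function.Injective (extRes.{w} X Y 0) := by
  intro e e' h
  apply Ext.addEquiv₀.injective
  apply homRes_injective X Y
  rw [← vertexEquiv₀_extRes.{w}, h, vertexEquiv₀_extRes]

theorem exact_extRes_extDiff_zero (X Y : DRep Φ) :
    Function.Exact (extRes.{w} X Y 0) (extDiff.{w} adj X Y 0) :=
  Function.Exact.of_ladder_addEquiv_of_exact' (e₁ := Ext.addEquiv₀)
    (e₂ := vertexEquiv₀ X.obj Y.obj) (e₃ := arrowEquiv₀ _ Y.obj)
    (AddMonoidHom.ext fun e => (vertexEquiv₀_extRes X Y e).symm)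
    (AddMonoidHom.ext fun e => (arrowEquiv₀_extDiff adj X Y e).symm)
    (exact_homRes_homDiff adj X Y)

/-! ### Dimension shifting over vertices and arrows -/

section ShortExact

variable {S : ShortComplex (DRep Φ)} (hS : S.ShortExact) (X : ∀ i, C i)
  (Z : ∀ (i j : Q), (i ⟶ j) → C j)

include hS in
theorem exact_comp_extRes_mk₀_mk₀ (k : ℕ) (i : Q) (M : C i) :
    Function.Exact
      (fun e : Ext.{w} M (S.X₁.obj i) k => e.comp (extRes _ _ _ (Ext.mk₀ S.f) i) (add_zero k))
      (fun e => e.comp (extRes _ _ _ (Ext.mk₀ S.g) i) (add_zero k)) := by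
  rw [extRes_mk₀, extRes_mk₀]
  exact exact_comp_mk₀_mk₀ (hS.map_of_exact (eval Φ i)) M k

theorem exact_comp_extRes_mk₀_extClass (k : ℕ) (i : Q) (M : C i) :
    Function.Exact
      (fun e : Ext.{w} M (S.X₂.obj i) k => e.comp (extRes _ _ _ (Ext.mk₀ S.g) i) (add_zero k))
      (fun e => e.comp (extRes _ _ _ hS.extClass i) rfl) := by
  rw [extRes_mk₀, extRes_extClass]
  exact exact_comp_mk₀_extClass (hS.map_of_exact (eval Φ i)) M k

theorem comp_extRes_extClass_surjective [∀ i, Injective (S.X₂.obj i)] (k : ℕ) (i : Q) (M : C i) :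
    Function.Surjective (fun e : Ext.{w} M (S.X₃.obj i) k =>
      e.comp (extRes _ _ _ hS.extClass i) rfl) := by
  rw [extRes_extClass]
  have : Subsingleton (Ext.{w} M (S.map (eval Φ i)).X₂ (k + 1)) :=
    Ext.subsingleton_of_injective M (S.X₂.obj i) k
  exact comp_extClass_surjective (hS.map_of_exact (eval Φ i)) M k

theorem vertexPostcomp_extClass_surjective [∀ i, Injective (S.X₂.obj i)] (k : ℕ) :
    Function.Surjective (vertexPostcomp (X := X) (extRes.{w} _ _ _ hS.extClass)
      (rfl : k + 1 = k + 1)) := by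
  intro e
  choose f hf using fun i => comp_extRes_extClass_surjective hS k i (X i) (e i)
  exact ⟨f, funext hf⟩

theorem arrowPostcomp_extClass_surjective [∀ i, Injective (S.X₂.obj i)] (k : ℕ) :
    Function.Surjective (arrowPostcomp (X := Z) (extRes.{w} _ _ _ hS.extClass)
      (rfl : k + 1 = k + 1)) := by
  intro e
  choose f hf using fun i j a => comp_extRes_extClass_surjective hS k j (Z i j a) (e i j a)
  exact ⟨f, funext fun i => funext fun j => funext fun a => hf i j a⟩

/-- The kernel is the image of `Ext` groups into injectives in degree `k + 1`, hence zero. In degree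
`0` that image consists of morphisms and need not vanish. -/
theorem vertexPostcomp_extClass_injective [∀ i, Injective (S.X₂.obj i)] (k : ℕ) :
    Function.Injective (vertexPostcomp (X := X) (extRes.{w} _ _ _ hS.extClass)
      (rfl : k + 1 + 1 = k + 1 + 1)) := by
  have (i : Q) := Ext.subsingleton_of_injective.{w} (X i) (S.X₂.obj i) k
  exact injective_of_exact_of_subsingleton
    (exact_vertexPostcomp (exact_comp_extRes_mk₀_extClass hS (k + 1)))

theorem arrowPostcomp_extClass_injective [∀ i, Injective (S.X₂.obj i)] (k : ℕ) :
    Function.Injective (arrowPostcomp (X := Z) (extRes.{w} _ _ _ hS.extClass)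
      (rfl : k + 1 + 1 = k + 1 + 1)) := by
  have (i j : Q) (a : i ⟶ j) := Ext.subsingleton_of_injective.{w} (Z i j a) (S.X₂.obj j) k
  exact injective_of_exact_of_subsingleton
    (exact_arrowPostcomp (exact_comp_extRes_mk₀_extClass hS (k + 1)))

include hS in
theorem arrowPostcomp_mk₀_injective : Function.Injective
    (arrowPostcomp (X := Z) (extRes.{w} _ _ _ (Ext.mk₀ S.f)) (add_zero 0)) := by
  have (i : Q) : Mono (S.f.app i) := (hS.map_of_exact (eval Φ i)).mono_f
  intro e e' h
  funext i j a
  refine Ext.postcomp_mk₀_injective_of_mono (Z i j a) (S.f.app j) ?_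
  have h' := congrFun (congrFun (congrFun h i) j) a
  rw [extRes_mk₀] at h'
  exact h'

end ShortExact

/-- The long exact sequence, cut into pieces which start in the various degrees. -/
theorem exists_extConnecting [Finite Q] [∀ i j : Q, Finite (i ⟶ j)] (X : DRep Φ) (k : ℕ) :
    ∀ Y : DRep Φ, ∃ δ : (∀ (i j : Q) (a : i ⟶ j), Ext.{w} ((Ψ a).obj (X.obj i)) (Y.obj j) k) →+
        Ext.{max t q u v} X Y (k + 1),
      Function.Exact (extDiff.{w} adj X Y k) δ ∧ Function.Exact δ (extRes.{w} X Y (k + 1)) ∧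
        Function.Exact (extRes.{w} X Y (k + 1)) (extDiff.{w} adj X Y (k + 1)) := by
  -- The induction keeps `Y` arbitrary, since degree `k + 1` for `Y` uses degree `k` for the
  -- quotient `S.X₃`.
  induction k with
  | zero =>
    intro Y
    obtain ⟨S, hS, rfl, _, _, hX⟩ := exists_shortExact_injective.{w} adj Y
    have := Ext.subsingleton_of_injective.{max t q u v} X S.X₂ 0
    exact exists_snake_connecting
      (πE := (Ext.mk₀ S.g).postcomp X (add_zero 0)) (sE := hS.extClass.postcomp X rfl)
      (exact_comp_mk₀_extClass hS X 0) (comp_extClass_surjective hS X 0)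
      (exact_vertexPostcomp (exact_comp_extRes_mk₀_mk₀ hS 0))
      (exact_vertexPostcomp (exact_comp_extRes_mk₀_extClass hS 0))
      (vertexPostcomp_extClass_surjective hS X.obj 0)
      (arrowPostcomp_mk₀_injective hS _)
      (exact_arrowPostcomp (exact_comp_extRes_mk₀_mk₀ hS 0))
      (exact_arrowPostcomp (exact_comp_extRes_mk₀_extClass hS 0))
      (exact_extRes_extDiff_zero adj X S.X₂) (extDiff_zero_surjective adj (hX X))
      (extRes_zero_injective X S.X₃) (exact_extRes_extDiff_zero adj X S.X₃)
      (fun x => extRes_comp _ x _) (fun x => extRes_comp _ x _)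
      (extDiff_vertexPostcomp adj _ (extDiff_extRes_mk₀ adj S.f))
      (extDiff_vertexPostcomp adj _ (extDiff_extRes_mk₀ adj S.g))
      (extDiff_vertexPostcomp adj _ (extDiff_extRes_extClass adj hS))
  | succ k ih =>
    intro Y
    obtain ⟨S, hS, rfl, _, _, hX⟩ := exists_shortExact_injective.{w} adj Y
    have := Ext.subsingleton_of_injective.{max t q u v} X S.X₂ k
    have := Ext.subsingleton_of_injective.{max t q u v} X S.X₂ (k + 1)
    obtain ⟨δ, hd, hδ, hr⟩ := ih S.X₃
    refine exists_shift_connecting (e := hS.extClass.postcomp X rfl)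
      (vertexPostcomp_extClass_surjective hS X.obj k)
      (arrowPostcomp_extClass_surjective hS _ k)
      ⟨injective_of_exact_of_subsingleton (f := (Ext.mk₀ S.g).postcomp X (add_zero _))
        (exact_comp_mk₀_extClass hS X (k + 1)), comp_extClass_surjective hS X (k + 1)⟩
      ⟨vertexPostcomp_extClass_injective hS X.obj k,
        vertexPostcomp_extClass_surjective hS X.obj (k + 1)⟩
      (arrowPostcomp_extClass_injective hS _ k) ?_
      (extDiff_vertexPostcomp adj _ (extDiff_extRes_extClass adj hS))
      (fun x => extRes_comp _ x _)
      (extDiff_vertexPostcomp adj _ (extDiff_extRes_extClass adj hS)) hd hδ hr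
    intro x hx
    -- It remains to lift the kernel of the connecting map over the arrows. In degree `0`, `x` comes
    -- from morphisms into `S.X₂`, where `homDiff` is surjective; the preimage is pushed forward to
    -- `S.X₃`. In positive degrees the kernel is zero.
    cases k with
    | zero =>
      obtain ⟨b, rfl⟩ := (exact_arrowPostcomp (exact_comp_extRes_mk₀_extClass hS 0) x).1 hx
      obtain ⟨f, rfl⟩ := extDiff_zero_surjective adj (hX X) b
      exact ⟨_, (exact_vertexPostcomp (exact_comp_extRes_mk₀_extClass hS 0)).apply_apply_eq_zero f,
        extDiff_vertexPostcomp adj _ (extDiff_extRes_mk₀ adj S.g) f⟩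
    | succ k =>
      refine ⟨0, map_zero _, ?_⟩
      rw [arrowPostcomp_extClass_injective hS _ k (hx.trans (map_zero _).symm), map_zero]

end LongExactSequence

end DRep

/-! ### Assembling the long exact sequence -/

theorem mainTheorem1 {Q : Type t} [Quiver.{q} Q] [Finite Q] [∀ i j : Q, Finite (i ⟶ j)]
    {C : Q → Type u} [∀ i, Category.{v} (C i)] [∀ i, Abelian (C i)]
    [∀ i, IsGrothendieckAbelian.{w} (C i)]
    (Φ : ∀ ⦃i j : Q⦄, (i ⟶ j) → C j ⥤ C i)
    [∀ (i j : Q) (a : i ⟶ j), (Φ a).Additive]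
    [∀ (i j : Q) (a : i ⟶ j), PreservesFiniteLimits (Φ a)]
    (Ψ : ∀ ⦃i j : Q⦄, (i ⟶ j) → C i ⥤ C j)
    [∀ (i j : Q) (a : i ⟶ j), (Ψ a).Additive]
    [∀ (i j : Q) (a : i ⟶ j), PreservesFiniteLimits (Ψ a)]
    [∀ (i j : Q) (a : i ⟶ j), PreservesFiniteColimits (Ψ a)]
    (adj : ∀ ⦃i j : Q⦄ (a : i ⟶ j), Ψ a ⊣ Φ a)
    (X Y : DRep Φ) :
    ∃ (δ₀ : (∀ (i j : Q) (a : i ⟶ j), (Ψ a).obj (X.obj i) ⟶ Y.obj j) →+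
          Abelian.Ext.{max t q u v} X Y 1)
      (δ : ∀ k : ℕ,
        (∀ (i j : Q) (a : i ⟶ j), Abelian.Ext.{w} ((Ψ a).obj (X.obj i)) (Y.obj j) (k + 1)) →+
          Abelian.Ext.{max t q u v} X Y (k + 2)),
      Function.Injective (DRep.homRes X Y) ∧
      Function.Exact (DRep.homRes X Y) (DRep.homDiff adj X Y) ∧
      Function.Exact (DRep.homDiff adj X Y) δ₀ ∧
      Function.Exact δ₀ (DRep.extRes.{w} X Y 1) ∧
      ∀ k : ℕ,
        Function.Exact (DRep.extRes.{w} X Y (k + 1)) (DRep.extDiff.{w} adj X Y (k + 1)) ∧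
        Function.Exact (DRep.extDiff.{w} adj X Y (k + 1)) (δ k) ∧
        Function.Exact (δ k) (DRep.extRes.{w} X Y (k + 2)) := by
  choose δ hd hδ hr using fun k => DRep.exists_extConnecting.{w} adj X k Y
  -- The pieces overlap in the `Ext` groups over `X`; only the first connecting map has to be moved
  -- along `Ext⁰ = Hom`.
  refine ⟨(δ 0).comp (DRep.arrowEquiv₀ _ Y.obj).symm.toAddMonoidHom, fun k => δ (k + 1),
    DRep.homRes_injective X Y, DRep.exact_homRes_homDiff adj X Y, ?_, ?_,
    fun k => ⟨hr k, hd (k + 1), hδ (k + 1)⟩⟩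
  · refine Function.Exact.of_ladder_addEquiv_of_exact (e₁ := DRep.vertexEquiv₀ X.obj Y.obj)
      (e₂ := DRep.arrowEquiv₀ _ Y.obj) (e₃ := AddEquiv.refl _)
      (AddMonoidHom.ext fun e => (DRep.arrowEquiv₀_extDiff adj X Y e).symm)
      (AddMonoidHom.ext fun e => ?_) (hd 0)
    exact congrArg (δ 0) ((DRep.arrowEquiv₀ _ Y.obj).symm_apply_apply e)
  · exact Function.Exact.of_ladder_addEquiv_of_exact (e₁ := DRep.arrowEquiv₀ _ Y.obj)
      (e₂ := AddEquiv.refl _) (e₃ := AddEquiv.refl _)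
      (AddMonoidHom.ext fun e =>
        congrArg (δ 0) ((DRep.arrowEquiv₀ _ Y.obj).symm_apply_apply e)) rfl (hδ 0)
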